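/- For integers $n\ge 2$ and $c\ge 1$, let $UV_n(c)$ be the group with generators $\rho_i$ ($1\le i\le n-1$) and $\sigma_{i,t}$ ($1\le i\le n-1$, $1\le t\le c$) and relations $$\rho_i\rho_{i+1}\rho_i=\rho_{i+1}\rho_i\rho_{i+1}\ (1\le i\le n-2),\qquad \rho_i\rho_j=\rho_j\rho_i\ (|i-j|\ge 2),\qquad \rho_i^2=1\ (1\le i\le n-1),$$ $$\sigma_{i,t}\sigma_{j,\ell}=\sigma_{j,\ell}\sigma_{i,t}\ (|i-j|\ge 2,\ 1\le t,\ell\le c),\qquad \sigma_{i,t}\rho_j=\rho_j\sigma_{i,t}\ (|i-j|\ge 2,\ 1\le t\le c),$$ $$\rho_i\rho_{i+1}\sigma_{i,t}=\sigma_{i+1,t}\rho_i\rho_{i+1}\ (1\le i\le n-2,\ 1\le t\le c).$$ Let $UW_n(c)$, the universal welded braid group, be the quotient of $UV_n(c)$ by the normal closure of the elements $$\rho_i\,\sigma_{i+1,t}\,\sigma_{i,t}\,(\sigma_{i+1,t}\,\sigma_{i,t}\,\rho_{i+1})^{-1},\qquad 1\le i\le n-2,\ 1\le t\le c.$$ Then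 for every $c\ge 1$: 1. for every $n\ge 3$, the center of $UW_n(c)$ is trivial; 2. $UW_2(c)\cong F_c * \mathbb{Z}_2$, where $F_c$ is the free group of rank $c$ and $\mathbb{Z}_2$ is the cyclic group of order $2$, and the center of $UW_2(c)$ is trivial. -/

import Mathlib

namespace UniversalWelded

/-- The generators `ρ_i` and `σ_{i,t}`, for `1 ≤ i ≤ n - 1` and `1 ≤ t ≤ c`; the indices are
written from `0`, so that `i : Fin (n - 1)` and `t : Fin c`. -/
inductive Gen (n c : ℕ) : Type
  | rho (i : Fin (n - 1)) : Gen n c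
  | sigma (i : Fin (n - 1)) (t : Fin c) : Gen n c

/-- The letter `ρ_i` in the free group on the generators. -/
def ρ {n c : ℕ} (i : Fin (n - 1)) : FreeGroup (Gen n c) := FreeGroup.of (Gen.rho i)

/-- The letter `σ_{i,t}` in the free group on the generators. -/
def σ {n c : ℕ} (i : Fin (n - 1)) (t : Fin c) : FreeGroup (Gen n c) :=
  FreeGroup.of (Gen.sigma i t)

/-- `|i - j| ≥ 2`. -/
def Far {m : ℕ} (i j : Fin m) : Prop := (i : ℕ) + 2 ≤ j ∨ (j : ℕ) + 2 ≤ i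

/-- `j = i + 1`. -/
def Next {m : ℕ} (i j : Fin m) : Prop := (j : ℕ) = i + 1

/-- The defining relations of the universal virtual braid group; a relation `u = v` is recorded
as the relator `u * v⁻¹`. -/
inductive VirtualRelator (n c : ℕ) : FreeGroup (Gen n c) → Prop
  /-- `ρ_i ρ_{i+1} ρ_i = ρ_{i+1} ρ_i ρ_{i+1}` -/
  | pr1 (i j : Fin (n - 1)) (h : Next i j) :
      VirtualRelator n c ((ρ i * ρ j * ρ i) * (ρ j * ρ i * ρ j)⁻¹)
  /-- `ρ_i ρ_j = ρ_j ρ_i` for `|i - j| ≥ 2` -/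
  | pr2 (i j : Fin (n - 1)) (h : Far i j) :
      VirtualRelator n c ((ρ i * ρ j) * (ρ j * ρ i)⁻¹)
  /-- `ρ_i ^ 2 = 1` -/
  | pr3 (i : Fin (n - 1)) : VirtualRelator n c (ρ i ^ 2)
  /-- `σ_{i,t} σ_{j,l} = σ_{j,l} σ_{i,t}` for `|i - j| ≥ 2` -/
  | cr (i j : Fin (n - 1)) (t l : Fin c) (h : Far i j) :
      VirtualRelator n c ((σ i t * σ j l) * (σ j l * σ i t)⁻¹)
  /-- `σ_{i,t} ρ_j = ρ_j σ_{i,t}` for `|i - j| ≥ 2` -/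
  | mr1 (i j : Fin (n - 1)) (t : Fin c) (h : Far i j) :
      VirtualRelator n c ((σ i t * ρ j) * (ρ j * σ i t)⁻¹)
  /-- `ρ_i ρ_{i+1} σ_{i,t} = σ_{i+1,t} ρ_i ρ_{i+1}` -/
  | mr2 (i j : Fin (n - 1)) (t : Fin c) (h : Next i j) :
      VirtualRelator n c ((ρ i * ρ j * σ i t) * (σ j t * ρ i * ρ j)⁻¹)

/-- The universal virtual braid group `UV_n(c)`. -/
abbrev UV (n c : ℕ) : Type := PresentedGroup {w | VirtualRelator n c w}

/-- The elements `ρ_i σ_{i+1,t} σ_{i,t} (σ_{i+1,t} σ_{i,t} ρ_{i+1})⁻¹` of `UV_n(c)`. -/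
def weldedRelators (n c : ℕ) : Set (UV n c) :=
  {w | ∃ (i j : Fin (n - 1)) (t : Fin c), Next i j ∧
    w = PresentedGroup.mk {w | VirtualRelator n c w}
      ((ρ i * σ j t * σ i t) * (σ j t * σ i t * ρ j)⁻¹)}

/-- The universal welded braid group `UW_n(c)`: the quotient of `UV_n(c)` by the normal closure
of the welded relators. -/
abbrev UW (n c : ℕ) : Type := UV n c ⧸ Subgroup.normalClosure (weldedRelators n c)

end UniversalWelded

/-! The group is a semidirect product of a right-angled Artin group with a symmetric group. Put `α =
σ_{i,t} ρ_i`. By the mixed relations the symmetric group permutes these elements by conjugation,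
which gives one element for each "arrow": an ordered pair of distinct letters with a label. In these
terms the commutation relations say that disjoint arrows commute, and the welded relations say that
arrows with the same target and label commute.

Let `(a, w)` commute with the generator at every arrow `v`. Then `a` conjugates the generator at `w
• v` to the one at `v`. Abelianizing gives `w • v = v`, and since the action on arrows is faithful,
`w = 1`. So `a` centralizes every generator. The centralizer of a generator is generated by the star
of its vertex (`mem_parabolic_star_of_commute`), and the stars have no common vertex, because no
arrow is adjacent to its reversal; hence `a = 1`. This covers `n = 2` as well.

To transfer this to the welded group it suffices that `toSemi` has the left inverse `fromSemi` and
that its image contains the arrow generators. That the element of an arrow is well defined rests on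
a coset normal form in the Coxeter group, which shows that the stabilizer of the first two letters
is generated by the later transpositions. For `n = 2` the only relation left is `ρ² = 1`, whence the
free product. -/

/-- An action of `G` on `A` by endomorphisms, as a homomorphism to the automorphism group. -/
def mulAutOfEnd {G A : Type*} [Group G] [Group A] (F : G → A →* A) (h1 : F 1 = MonoidHom.id A)
    (hmul : ∀ g h, F (g * h) = (F g).comp (F h)) : G →* MulAut A where
  toFun g := (F g).toMulEquiv (F g⁻¹) (by rw [← hmul, inv_mul_cancel, h1])
    (by rw [← hmul, mul_inv_cancel, h1])
  map_one' := by ext a; exact DFunLike.congr_fun h1 a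
  map_mul' g h := by ext a; exact DFunLike.congr_fun (hmul g h) a

@[simp] theorem mulAutOfEnd_apply {G A : Type*} [Group G] [Group A] (F : G → A →* A)
    (h1 : F 1 = MonoidHom.id A) (hmul : ∀ g h, F (g * h) = (F g).comp (F h)) (g : G) (a : A) :
    mulAutOfEnd F h1 hmul g a = F g a := rfl

/-! ### Centralizers of basis elements in free groups. -/

namespace FreeGroup

/-- A leading letter `x` or `x⁻¹` can be stripped off. If the first letter is another one, `x · L`
is already reduced, so it has the same length as `L ++ [x]`, of which the reduced word of `L · x` is
a sublist; the two words then agree, and their first letters clash. -/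
theorem mk_mem_zpowers_of_commute {X : Type*} (x : X) :
    ∀ L : List (X × Bool), IsReduced L → Commute (of x) (mk L) →
      mk L ∈ Subgroup.zpowers (of x) := by
  classical
  intro L
  induction L with
  | nil => intro _ _; exact one_mem _
  | cons p w ih =>
    intro hL hc
    obtain ⟨y, b⟩ := p
    have hsplit : mk ((y, b) :: w) = mk [(y, b)] * mk w := by rw [mul_mk]; rfl
    by_cases hyx : y = x
    · subst hyx
      have hy : mk [(y, b)] ∈ Subgroup.zpowers (of y) := by
        cases b
        · exact inv_mem (Subgroup.mem_zpowers (of y))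
        · exact Subgroup.mem_zpowers (of y)
      have hcy : Commute (of y) (mk [(y, b)]) := by
        obtain ⟨k, hk⟩ := hy
        exact hk ▸ (Commute.refl (of y)).zpow_right k
      rw [hsplit] at hc ⊢
      refine mul_mem hy (ih ?_ ?_)
      · exact hL.infix (List.suffix_cons _ _).isInfix
      · have := hcy.inv_right.mul_right hc
        rwa [inv_mul_cancel_left] at this
    · exfalso
      have hred : IsReduced ((x, true) :: (y, b) :: w) :=
        List.IsChain.cons_cons (fun h => absurd h.symm hyx) hL
      have h1 : (of x * mk ((y, b) :: w)).toWord = (x, true) :: (y, b) :: w := by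
        rw [← hred.reduce_eq, ← toWord_mk]; rfl
      have h2 := toWord_mul_sublist (mk ((y, b) :: w)) (of x)
      rw [← hc.eq, h1, toWord_mk, hL.reduce_eq, toWord_of] at h2
      have h3 := h2.eq_of_length (by simp)
      simp only [List.cons_append, List.cons.injEq, Prod.mk.injEq] at h3
      exact hyx h3.1.1.symm

/-- The centralizer of a free generator is the cyclic group that it generates. -/
theorem mem_zpowers_of_commute_of {X : Type*} {x : X} {n : FreeGroup X} (h : Commute (of x) n) :
    n ∈ Subgroup.zpowers (of x) := by
  classical
  have := mk_mem_zpowers_of_commute x n.toWord isReduced_toWord (by rwa [mk_toWord])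
  rwa [mk_toWord] at this

/-- Conjugation preserves the exponent sum in `x`. -/
theorem eq_of_conj_of_eq_of {X : Type*} {x y : X} {n : FreeGroup X}
    (h : n * of y * n⁻¹ = of x) : y = x := by
  classical
  by_contra hyx
  let f : FreeGroup X →* Multiplicative ℤ :=
    lift fun z => if z = x then Multiplicative.ofAdd (1 : ℤ) else 1
  have hx : f (of x) = Multiplicative.ofAdd (1 : ℤ) := by simp [f]
  have hy : f (of y) = 1 := by simp [f, hyx]
  have := congrArg f h
  rw [_root_.map_mul, _root_.map_mul, hx, hy, mul_one, _root_.map_inv, mul_inv_cancel] at this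
  exact zero_ne_one (Multiplicative.ofAdd.injective this)

/-- Permutations of the basis act on a free group. -/
def autOfAction (G X : Type*) [Group G] [MulAction G X] : G →* MulAut (FreeGroup X) :=
  mulAutOfEnd (fun g => map (g • ·)) (by ext x; simp) (by intro g h; ext x; simp [mul_smul])

@[simp] theorem autOfAction_of {G X : Type*} [Group G] [MulAction G X] (g : G) (x : X) :
    autOfAction G X g (of x) = of (g • x) := by
  simp [autOfAction]

end FreeGroup

/-! ### Right-angled Artin groups: parabolic subgroups, centralizers, center. -/

/-- The right-angled Artin group of a graph: one generator for each vertex, adjacent vertices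
commute. -/
abbrev RightAngledArtin {V : Type*} (Γ : SimpleGraph V) : Type _ :=
  PresentedGroup {x : FreeGroup V | ∃ u v, Γ.Adj u v ∧ x = FreeGroup.of u * FreeGroup.of v * (FreeGroup.of v * FreeGroup.of u)⁻¹}

namespace RightAngledArtin

variable {V : Type*} {Γ : SimpleGraph V}

/-- The generator at a vertex. -/
def gen (Γ : SimpleGraph V) (v : V) : RightAngledArtin Γ := PresentedGroup.of v

theorem commute_gen {u v : V} (h : Γ.Adj u v) : Commute (gen Γ u) (gen Γ v) := by
  rw [commute_iff_eq, ← mul_inv_eq_one]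
  exact PresentedGroup.one_of_mem (rels := {x : FreeGroup V | ∃ u v, Γ.Adj u v ∧
    x = FreeGroup.of u * FreeGroup.of v * (FreeGroup.of v * FreeGroup.of u)⁻¹}) ⟨u, v, h, rfl⟩

/-- The homomorphism determined by its values on the generators. -/
def lift {G : Type*} [Group G] (f : V → G) (hf : ∀ u v, Γ.Adj u v → Commute (f u) (f v)) :
    RightAngledArtin Γ →* G :=
  PresentedGroup.toGroup (f := f) (by
    rintro _ ⟨u, v, h, rfl⟩
    simpa [mul_inv_eq_one, -mul_inv_rev] using (hf u v h).eq)

@[simp] theorem lift_gen {G : Type*} [Group G] (f : V → G)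
    (hf : ∀ u v, Γ.Adj u v → Commute (f u) (f v)) (v : V) : lift f hf (gen Γ v) = f v :=
  PresentedGroup.toGroup.of _

theorem hom_ext {G : Type*} [Group G] {f g : RightAngledArtin Γ →* G}
    (h : ∀ v, f (gen Γ v) = g (gen Γ v)) : f = g :=
  PresentedGroup.ext h

/-- The subgroup generated by a set of vertices. -/
def parabolic (Γ : SimpleGraph V) (S : Set V) : Subgroup (RightAngledArtin Γ) :=
  Subgroup.closure (gen Γ '' S)

theorem gen_mem_parabolic {S : Set V} {v : V} (h : v ∈ S) : gen Γ v ∈ parabolic Γ S :=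
  Subgroup.subset_closure ⟨v, h, rfl⟩

theorem parabolic_univ : parabolic Γ Set.univ = ⊤ := by
  rw [parabolic, Set.image_univ]
  exact PresentedGroup.closure_range_of _

open Classical in
/-- The retraction onto the subgroup generated by a set of vertices. -/
noncomputable def retract (Γ : SimpleGraph V) (S : Set V) :
    RightAngledArtin Γ →* RightAngledArtin Γ :=
  lift (fun v => if v ∈ S then gen Γ v else 1) (by
    intro u v h
    by_cases hu : u ∈ S <;> by_cases hv : v ∈ S <;> simp [hu, hv, commute_gen h])

theorem retract_of_mem {S : Set V} {a : RightAngledArtin Γ} (ha : a ∈ parabolic Γ S) :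
    retract Γ S a = a := by
  have : parabolic Γ S ≤ (retract Γ S).eqLocus (MonoidHom.id _) := by
    rw [parabolic, Subgroup.closure_le]
    rintro _ ⟨v, hv, rfl⟩
    simp [retract, MonoidHom.eqLocus, hv]
  exact this ha

theorem retract_mem {S T : Set V} {a : RightAngledArtin Γ} (ha : a ∈ parabolic Γ T) :
    retract Γ S a ∈ parabolic Γ (S ∩ T) := by
  have : parabolic Γ T ≤ (parabolic Γ (S ∩ T)).comap (retract Γ S) := by
    rw [parabolic, Subgroup.closure_le]
    rintro _ ⟨v, hv, rfl⟩
    by_cases hs : v ∈ S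
    · simpa [retract, hs] using gen_mem_parabolic (Γ := Γ) (S := S ∩ T) ⟨hs, hv⟩
    · simp [retract, hs]
  exact this ha

/-- The retraction for `S` fixes the first subgroup pointwise and kills the generators of the second
that lie outside `S`. -/
theorem mem_parabolic_inter {S T : Set V} {a : RightAngledArtin Γ} (hS : a ∈ parabolic Γ S)
    (hT : a ∈ parabolic Γ T) : a ∈ parabolic Γ (S ∩ T) := by
  rw [← retract_of_mem hS]
  exact retract_mem hT

/-- The cosets of the subgroup generated by the neighbours of `v`. -/
abbrev LinkCosets (Γ : SimpleGraph V) (v : V) : Type _ :=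
  RightAngledArtin Γ ⧸ parabolic Γ (Γ.neighborSet v)

open Classical in
/-- The homomorphism that separates the conjugates of the generator at `v` from the other
generators. -/
noncomputable def split (Γ : SimpleGraph V) (v : V) : RightAngledArtin Γ →*
    FreeGroup (LinkCosets Γ v) ⋊[FreeGroup.autOfAction (RightAngledArtin Γ) (LinkCosets Γ v)]
      RightAngledArtin Γ :=
  lift (fun w => if w = v then SemidirectProduct.inl (FreeGroup.of ((1 : RightAngledArtin Γ) :
      LinkCosets Γ v)) else SemidirectProduct.inr (gen Γ w)) (by
    -- Only edges at `v` need care: a neighbour of `v` fixes the trivial coset of the link subgroup,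
    -- hence commutes with the free generator at that coset.
    have key : ∀ w, Γ.Adj v w → Commute
        (SemidirectProduct.inl (φ := FreeGroup.autOfAction (RightAngledArtin Γ) (LinkCosets Γ v))
          (FreeGroup.of ((1 : RightAngledArtin Γ) : LinkCosets Γ v)))
        (SemidirectProduct.inr (gen Γ w)) := by
      intro w h
      have hfix : gen Γ w • ((1 : RightAngledArtin Γ) : LinkCosets Γ v) =
          ((1 : RightAngledArtin Γ) : LinkCosets Γ v) := by
        rw [MulAction.Quotient.smul_coe, smul_eq_mul, mul_one, eq_comm, QuotientGroup.eq, inv_one,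
          one_mul]
        exact gen_mem_parabolic h
      ext <;> simp [hfix]
    intro u w h
    by_cases hu : u = v
    · subst hu
      simpa [h.ne'] using key w h
    · by_cases hw : w = v
      · subst hw
        simpa [hu] using (key u h.symm).symm
      · simpa [hu, hw] using (commute_gen h).map SemidirectProduct.inr)

/-- This makes the conjugate of the generator at `v` depend only on the coset of the conjugating
element. -/
theorem commute_of_mem_link {v : V} {g : RightAngledArtin Γ}
    (hg : g ∈ parabolic Γ (Γ.neighborSet v)) : Commute g (gen Γ v) := by
  have : parabolic Γ (Γ.neighborSet v) ≤ Subgroup.centralizer {gen Γ v} := by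
    rw [parabolic, Subgroup.closure_le]
    rintro _ ⟨w, hw, rfl⟩
    rw [SetLike.mem_coe, Subgroup.mem_centralizer_singleton_iff]
    exact (commute_gen (Γ.adj_symm hw)).eq
  exact Subgroup.mem_centralizer_singleton_iff.1 (this hg)

/-- The conjugate of the generator at `v` by a coset of the link subgroup. -/
def conjGen (Γ : SimpleGraph V) (v : V) : LinkCosets Γ v → RightAngledArtin Γ :=
  Quotient.lift (fun g => g * gen Γ v * g⁻¹) (by
    intro a b h
    have h := (commute_of_mem_link (QuotientGroup.leftRel_apply.1 h)).eq
    have h2 : b * gen Γ v = a * gen Γ v * a⁻¹ * b := by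
      calc b * gen Γ v = a * (a⁻¹ * b * gen Γ v) := by group
        _ = _ := by rw [h]; group
    change a * gen Γ v * a⁻¹ = b * gen Γ v * b⁻¹
    rw [h2]; group)

@[simp] theorem conjGen_coe (v : V) (g : RightAngledArtin Γ) :
    conjGen Γ v (g : LinkCosets Γ v) = g * gen Γ v * g⁻¹ := rfl

/-- The left inverse of `split`. -/
def unsplit (Γ : SimpleGraph V) (v : V) :
    FreeGroup (LinkCosets Γ v) ⋊[FreeGroup.autOfAction (RightAngledArtin Γ) (LinkCosets Γ v)]
      RightAngledArtin Γ →* RightAngledArtin Γ :=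
  SemidirectProduct.lift (FreeGroup.lift (conjGen Γ v)) (MonoidHom.id _) (by
    intro g
    ext x
    induction x using QuotientGroup.induction_on with | _ h => ?_
    simp [mul_assoc])

theorem unsplit_split (v : V) (a : RightAngledArtin Γ) : unsplit Γ v (split Γ v a) = a := by
  have : (unsplit Γ v).comp (split Γ v) = MonoidHom.id _ := by
    refine hom_ext fun w => ?_
    by_cases hw : w = v
    · subst hw
      simp [split, unsplit]
    · simp [split, unsplit, hw]
  exact DFunLike.congr_fun this a

/-- The centralizer of a generator is generated by the star of its vertex. -/
theorem mem_parabolic_star_of_commute {v : V} {a : RightAngledArtin Γ}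
    (h : Commute a (gen Γ v)) : a ∈ parabolic Γ (insert v (Γ.neighborSet v)) := by
  have hs := (h.map (split Γ v)).eq
  have hv : split Γ v (gen Γ v) =
      SemidirectProduct.inl (FreeGroup.of ((1 : RightAngledArtin Γ) : LinkCosets Γ v)) := by
    simp [split]
  rw [hv] at hs
  set s := split Γ v a with hsdef
  have ha : a = FreeGroup.lift (conjGen Γ v) s.left * s.right := by
    rw [← unsplit_split v a, ← hsdef]
    rfl
  have hl := congrArg SemidirectProduct.left hs
  simp only [SemidirectProduct.mul_left, SemidirectProduct.left_inl, SemidirectProduct.right_inl,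
    FreeGroup.autOfAction_of, map_one, MulAut.one_apply] at hl
  -- The free part of `s` conjugates the basis element at the translate of the trivial coset by
  -- `s.right` to the one at the trivial coset. So `s.right` fixes that coset, which puts it in the
  -- link subgroup, and `s.left` is then a power of a basis element.
  have hfix := FreeGroup.eq_of_conj_of_eq_of (mul_inv_eq_iff_eq_mul.2 hl)
  rw [hfix] at hl
  obtain ⟨k, hk⟩ := FreeGroup.mem_zpowers_of_commute_of hl.symm
  have hr : s.right ∈ parabolic Γ (Γ.neighborSet v) := by
    rw [MulAction.Quotient.smul_coe, smul_eq_mul, mul_one, eq_comm, QuotientGroup.eq, inv_one,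
      one_mul] at hfix
    exact hfix
  rw [ha, ← hk]
  refine mul_mem ?_ (Subgroup.closure_mono (Set.image_mono (Set.subset_insert _ _)) hr)
  simpa using zpow_mem (gen_mem_parabolic (Γ := Γ) (Set.mem_insert v (Γ.neighborSet v))) k

/-- If no vertex is adjacent to all others, the center is trivial. -/
theorem eq_one_of_commute_gen [Finite V] (hΓ : ∀ v, ∃ u, u ≠ v ∧ ¬ Γ.Adj v u)
    {a : RightAngledArtin Γ} (ha : ∀ v, Commute a (gen Γ v)) : a = 1 := by
  classical
  have := Fintype.ofFinite V
  -- Vertices are removed one at a time: to drop `v`, intersect with the star of some `u ≠ v` not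
  -- adjacent to `v`, as this star omits `v`.
  have key : ∀ S : Finset V, a ∈ parabolic Γ ((S : Set V)ᶜ) := by
    intro S
    induction S using Finset.induction_on with
    | empty => simp [parabolic_univ]
    | insert v S _ ih =>
      obtain ⟨u, huv, hadj⟩ := hΓ v
      refine Subgroup.closure_mono (Set.image_mono ?_)
        (mem_parabolic_inter ih (mem_parabolic_star_of_commute (ha u)))
      rintro w ⟨hw, rfl | hw'⟩ hmem
      all_goals
        rcases Finset.mem_insert.1 (Finset.mem_coe.1 hmem) with rfl | h
        · first | exact huv rfl | exact hadj (Γ.adj_symm hw')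
        · exact hw h
  simpa [parabolic] using key Finset.univ

/-- A generator is conjugate to no other generator. -/
theorem eq_of_conj_gen {u v : V} {a : RightAngledArtin Γ} (h : a * gen Γ u * a⁻¹ = gen Γ v) :
    u = v := by
  classical
  by_contra huv
  have := congrArg (lift (Γ := Γ) (fun z => if z = v then Multiplicative.ofAdd (1 : ℤ) else 1)
    fun _ _ _ => Commute.all _ _) h
  simp only [map_mul, map_inv, lift_gen, if_neg huv, mul_one, mul_inv_cancel, if_true] at this
  exact zero_ne_one (Multiplicative.ofAdd.injective this)

/-- A group that acts on the graph acts on the right-angled Artin group. -/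
def autOfAction (Γ : SimpleGraph V) (G : Type*) [Group G] [MulAction G V]
    (hG : ∀ (g : G) u v, Γ.Adj u v → Γ.Adj (g • u) (g • v)) : G →* MulAut (RightAngledArtin Γ) :=
  mulAutOfEnd (fun g => lift (fun v => gen Γ (g • v)) fun u v h => commute_gen (hG g u v h))
    (by refine hom_ext ?_; simp)
    (by intro g h; refine hom_ext ?_; simp [mul_smul])

@[simp] theorem autOfAction_gen {G : Type*} [Group G] [MulAction G V]
    (hG : ∀ (g : G) u v, Γ.Adj u v → Γ.Adj (g • u) (g • v)) (g : G) (v : V) :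
    autOfAction Γ G hG g (gen Γ v) = gen Γ (g • v) := by
  simp [autOfAction]

/-- The semidirect product with a group that acts faithfully on the vertices has trivial center if
no vertex is adjacent to all others. -/
theorem semidirectProduct_eq_one_of_commute [Finite V] (hΓ : ∀ v, ∃ u, u ≠ v ∧ ¬ Γ.Adj v u)
    {G : Type*} [Group G] [MulAction G V]
    (hG : ∀ (g : G) u v, Γ.Adj u v → Γ.Adj (g • u) (g • v))
    (hfaith : ∀ g : G, (∀ v : V, g • v = v) → g = 1)
    {z : RightAngledArtin Γ ⋊[autOfAction Γ G hG] G}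
    (hz : ∀ v, Commute z (SemidirectProduct.inl (gen Γ v))) : z = 1 := by
  have hl : ∀ v, z.left * gen Γ (z.right • v) = gen Γ v * z.left := by
    intro v
    have := congrArg SemidirectProduct.left (hz v).eq
    simpa using this
  have hr : z.right = 1 := hfaith _ fun v => eq_of_conj_gen (mul_inv_eq_iff_eq_mul.2 (hl v))
  ext1
  · refine eq_one_of_commute_gen hΓ fun v => ?_
    rw [commute_iff_eq, ← hl v, hr, one_smul]
  · exact hr

end RightAngledArtin

/-! ### The Coxeter presentation of the symmetric group and its point stabilizers. -/

namespace UniversalWelded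

/-- The Coxeter relators of the symmetric group. -/
inductive CoxeterRelator (m : ℕ) : FreeGroup (Fin m) → Prop
  | braid (i j : Fin m) (h : Next i j) : CoxeterRelator m
      ((.of i * .of j * .of i) * (.of j * .of i * .of j)⁻¹)
  | far (i j : Fin m) (h : Far i j) : CoxeterRelator m ((.of i * .of j) * (.of j * .of i)⁻¹)
  | sq (i : Fin m) : CoxeterRelator m (.of i ^ 2)

/-- The symmetric group on `m + 1` letters, given by its Coxeter presentation. -/
abbrev CoxeterSymm (m : ℕ) : Type := PresentedGroup {w | CoxeterRelator m w}

namespace CoxeterSymm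

/-- The Coxeter generators. -/
def gen {m : ℕ} (i : Fin m) : CoxeterSymm m := PresentedGroup.of i

theorem gen_mul_self {m : ℕ} (i : Fin m) : gen i * gen i = 1 := by
  rw [← pow_two]
  exact PresentedGroup.one_of_mem (rels := {w | CoxeterRelator m w}) (CoxeterRelator.sq i)

theorem gen_inv {m : ℕ} (i : Fin m) : (gen i)⁻¹ = gen i :=
  inv_eq_of_mul_eq_one_left (gen_mul_self i)

theorem gen_commute {m : ℕ} {i j : Fin m} (h : Far i j) : Commute (gen i) (gen j) :=
  PresentedGroup.mk_eq_mk_of_mul_inv_mem (rels := {w | CoxeterRelator m w})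
    (CoxeterRelator.far i j h)

theorem gen_braid {m : ℕ} {i j : Fin m} (h : Next i j) :
    gen i * gen j * gen i = gen j * gen i * gen j :=
  PresentedGroup.mk_eq_mk_of_mul_inv_mem (rels := {w | CoxeterRelator m w})
    (CoxeterRelator.braid i j h)

/-- The homomorphism determined by its values on the generators. -/
def lift {m : ℕ} {G : Type*} [Group G] (f : Fin m → G) (hsq : ∀ i, f i * f i = 1)
    (hfar : ∀ i j, Far i j → Commute (f i) (f j))
    (hbraid : ∀ i j, Next i j → f i * f j * f i = f j * f i * f j) : CoxeterSymm m →* G :=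
  PresentedGroup.toGroup (f := f) (by
    rintro _ (⟨i, j, h⟩ | ⟨i, j, h⟩ | ⟨i⟩)
    · simpa [mul_inv_eq_one, -mul_inv_rev] using hbraid i j h
    · simpa [mul_inv_eq_one, -mul_inv_rev] using (hfar i j h).eq
    · simpa [pow_two] using hsq i)

@[simp] theorem lift_gen {m : ℕ} {G : Type*} [Group G] (f : Fin m → G) (hsq : ∀ i, f i * f i = 1)
    (hfar : ∀ i j, Far i j → Commute (f i) (f j))
    (hbraid : ∀ i j, Next i j → f i * f j * f i = f j * f i * f j) (i : Fin m) :
    lift f hsq hfar hbraid (gen i) = f i :=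
  PresentedGroup.toGroup.of _

theorem induction {m : ℕ} {P : CoxeterSymm m → Prop} (one : P 1)
    (mul : ∀ i w, P w → P (gen i * w)) (w : CoxeterSymm m) : P w := by
  have hw : w ∈ Subgroup.closure (Set.range (gen (m := m))) := by
    rw [show Subgroup.closure (Set.range (gen (m := m))) = ⊤ from
      PresentedGroup.closure_range_of _]
    trivial
  induction hw using Subgroup.closure_induction_left with
  | one => exact one
  | mul_left x hx y _ ih =>
    obtain ⟨i, rfl⟩ := hx
    exact mul i y ih
  | inv_mul_cancel x hx y _ ih =>
    obtain ⟨i, rfl⟩ := hx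
    rw [gen_inv]
    exact mul i y ih

/-- The action on the letters, by adjacent transpositions. -/
def toPerm (m : ℕ) : CoxeterSymm m →* Equiv.Perm (Fin (m + 1)) :=
  lift (fun i => Equiv.swap i.castSucc i.succ) (fun i => Equiv.swap_mul_self _ _)
    (by
      intro i j h
      refine Equiv.Perm.Disjoint.commute (Equiv.Perm.disjoint_swap_swap ?_)
      rcases h with h | h <;> simp [Fin.ext_iff] <;> omega)
    (by
      intro i j h
      have hij : i.succ = j.castSucc := Fin.ext h.symm
      have h1 : j.castSucc ≠ i.castSucc := by
        rw [← hij]; exact i.castSucc_lt_succ.ne'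
      have h2 : j.succ ≠ j.castSucc := j.castSucc_lt_succ.ne'
      have h3 : j.succ ≠ i.castSucc := by
        rw [Ne, Fin.ext_iff]; simp [show (j : ℕ) = i + 1 from h]; omega
      rw [hij]
      have e1 := Equiv.swap_mul_swap_mul_swap h2 h3
      have e2 := Equiv.swap_mul_swap_mul_swap h1.symm h3.symm
      rw [Equiv.swap_comm j.castSucc i.castSucc, Equiv.swap_comm j.succ j.castSucc] at e1
      rw [e1, e2, Equiv.swap_comm])

@[simp] theorem toPerm_gen {m : ℕ} (i : Fin m) :
    toPerm m (gen i) = Equiv.swap i.castSucc i.succ := lift_gen _ _ _ _ i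

theorem toPerm_surjective (m : ℕ) : Function.Surjective (toPerm m) := by
  rw [← MonoidHom.mrange_eq_top, eq_top_iff, ← Equiv.Perm.mclosure_swap_castSucc_succ,
    Submonoid.closure_le]
  rintro _ ⟨i, rfl⟩
  exact ⟨gen i, toPerm_gen i⟩

/-- The inclusion of the subgroup that fixes the first letter. -/
def shift (m : ℕ) : CoxeterSymm m →* CoxeterSymm (m + 1) :=
  lift (fun i => gen i.succ) (fun i => gen_mul_self _)
    (fun i j h => gen_commute (by simpa [Far] using h))
    (fun i j h => gen_braid (by simpa [Next] using h))

@[simp] theorem shift_gen {m : ℕ} (i : Fin m) : shift m (gen i) = gen i.succ :=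
  lift_gen _ _ _ _ i

theorem toPerm_shift_zero {m : ℕ} (k : CoxeterSymm m) : toPerm (m + 1) (shift m k) 0 = 0 := by
  induction k using induction with
  | one => simp
  | mul i w ih =>
    rw [map_mul, map_mul, Equiv.Perm.mul_apply, ih, shift_gen, toPerm_gen]
    exact Equiv.swap_apply_of_ne_of_ne (by simp [Fin.ext_iff]) (by simp [Fin.ext_iff])

theorem toPerm_shift_succ {m : ℕ} (k : CoxeterSymm m) (x : Fin (m + 1)) :
    toPerm (m + 1) (shift m k) x.succ = (toPerm m k x).succ := by
  induction k using induction with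
  | one => simp
  | mul i w ih =>
    rw [map_mul, map_mul, Equiv.Perm.mul_apply, ih, shift_gen, toPerm_gen, map_mul,
      Equiv.Perm.mul_apply, toPerm_gen, ← Fin.succ_castSucc]
    exact ((Fin.succ_injective _).swap_apply _ _ _)

/-- The generators indexed by all natural numbers, trivial out of range. -/
def natGen (m i : ℕ) : CoxeterSymm m := if h : i < m then gen ⟨i, h⟩ else 1

theorem natGen_mul_self (m i : ℕ) : natGen m i * natGen m i = 1 := by
  unfold natGen
  split
  · exact gen_mul_self _
  · simp

theorem natGen_commute (m : ℕ) {i j : ℕ} (h : i + 2 ≤ j) :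
    Commute (natGen m i) (natGen m j) := by
  unfold natGen
  split
  · split
    · exact gen_commute (Or.inl h)
    · exact Commute.one_right _
  · exact Commute.one_left _

theorem natGen_braid {m i : ℕ} (h : i + 1 < m) :
    natGen m i * natGen m (i + 1) * natGen m i =
      natGen m (i + 1) * natGen m i * natGen m (i + 1) := by
  rw [natGen, natGen, dif_pos h, dif_pos (by omega)]
  exact gen_braid rfl

/-- The representative `ρ_j ⋯ ρ_2 ρ_1` of the coset of elements that send the first letter to the
letter `j`. -/
def cosetRep (m : ℕ) : ℕ → CoxeterSymm m
  | 0 => 1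
  | j + 1 => natGen m j * cosetRep m j

theorem natGen_commute_cosetRep (m : ℕ) {i j : ℕ} (h : j + 1 ≤ i) :
    Commute (natGen m i) (cosetRep m j) := by
  induction j with
  | zero => exact Commute.one_right _
  | succ j ih => exact (natGen_commute m h).symm.mul_right (ih (by omega))

/-- The braid relation raises the index by one when the generator meets the factors `i + 1` and `i`;
all other factors commute past. -/
theorem natGen_mul_cosetRep {m i j : ℕ} (hij : i + 2 ≤ j) (hj : j ≤ m) :
    natGen m i * cosetRep m j = cosetRep m j * natGen m (i + 1) := by
  induction j, hij using Nat.le_induction with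
  | base =>
    have hc : Commute (natGen m (i + 1)) (cosetRep m i) := natGen_commute_cosetRep m le_rfl
    calc natGen m i * cosetRep m (i + 2)
        = natGen m i * natGen m (i + 1) * natGen m i * cosetRep m i := by
          simp only [cosetRep, mul_assoc]
      _ = natGen m (i + 1) * natGen m i * (natGen m (i + 1) * cosetRep m i) := by
          rw [natGen_braid (by omega), mul_assoc]
      _ = cosetRep m (i + 2) * natGen m (i + 1) := by
          rw [hc.eq]; simp only [cosetRep, mul_assoc]
  | succ j hij ih =>
    rw [cosetRep, ← mul_assoc, (natGen_commute m hij).eq, mul_assoc, ih (by omega), mul_assoc]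

theorem natGen_succ_mem_range_shift (m i : ℕ) :
    natGen (m + 1) (i + 1) ∈ (shift m).range := by
  unfold natGen
  split
  · exact ⟨gen ⟨i, by omega⟩, shift_gen _⟩
  · exact one_mem _

/-- Multiplying a representative by a generator on the left lengthens it (`i = j`), shortens it (`i
= j - 1`), or passes through as a generator of positive index, which lies in the range of `shift`.
-/
theorem exists_eq_cosetRep_mul_shift {m : ℕ} (w : CoxeterSymm (m + 1)) :
    ∃ j ≤ m + 1, ∃ k ∈ (shift m).range, w = cosetRep (m + 1) j * k := by
  induction w using induction with
  | one => exact ⟨0, Nat.zero_le _, 1, one_mem _, by simp [cosetRep]⟩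
  | mul i w ih =>
    obtain ⟨j, hj, k, hk, rfl⟩ := ih
    have hi : gen i = natGen (m + 1) i := by rw [natGen, dif_pos i.2]
    have hlt := i.2
    rw [hi]
    rcases lt_trichotomy (i : ℕ) j with h | h | h
    · obtain ⟨j, rfl⟩ : ∃ j', j = j' + 1 := ⟨j - 1, by omega⟩
      rcases (Nat.lt_succ_iff.1 h).eq_or_lt with h | h
      · refine ⟨j, by omega, k, hk, ?_⟩
        rw [h, cosetRep, mul_assoc, ← mul_assoc, natGen_mul_self, one_mul]
      · refine ⟨j + 1, hj, _, mul_mem (natGen_succ_mem_range_shift m i) hk, ?_⟩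
        rw [← mul_assoc, natGen_mul_cosetRep (by omega) hj, mul_assoc]
    · exact ⟨j + 1, by omega, k, hk, by rw [h, cosetRep, mul_assoc]⟩
    · obtain ⟨i', hi'⟩ : ∃ i', (i : ℕ) = i' + 1 := ⟨i - 1, by omega⟩
      refine ⟨j, hj, _, mul_mem (natGen_succ_mem_range_shift m i') hk, ?_⟩
      rw [← mul_assoc, hi', (natGen_commute_cosetRep (m + 1) (by omega)).eq, mul_assoc]

theorem toPerm_cosetRep {m j : ℕ} (hj : j ≤ m) :
    toPerm m (cosetRep m j) 0 = ⟨j, Nat.lt_succ_of_le hj⟩ := by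
  induction j with
  | zero => simp [cosetRep]
  | succ j ih =>
    rw [cosetRep, map_mul, Equiv.Perm.mul_apply, ih (by omega), natGen, dif_pos (by omega),
      toPerm_gen]
    exact Equiv.swap_apply_left _ _

theorem mem_range_shift {m : ℕ} {w : CoxeterSymm (m + 1)} (h : toPerm (m + 1) w 0 = 0) :
    w ∈ (shift m).range := by
  obtain ⟨j, hj, k, ⟨k, rfl⟩, rfl⟩ := exists_eq_cosetRep_mul_shift w
  rw [map_mul, Equiv.Perm.mul_apply, toPerm_shift_zero, toPerm_cosetRep hj, Fin.ext_iff] at h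
  obtain rfl : j = 0 := h
  exact ⟨k, by simp [cosetRep]⟩

/-- Faithfulness by induction on `m`: an element fixing the first letter comes from the smaller
group. -/
theorem eq_one_of_toPerm_eq_one {m : ℕ} {w : CoxeterSymm m} (h : toPerm m w = 1) : w = 1 := by
  induction m with
  | zero =>
    induction w using induction with
    | one => rfl
    | mul i => exact i.elim0
  | succ m ih =>
    obtain ⟨k, rfl⟩ := mem_range_shift (w := w) (by simp [h])
    rw [ih (w := k) ?_, map_one]
    ext1 x
    apply Fin.succ_injective
    rw [← toPerm_shift_succ, h]
    rfl

/-- The subgroup generated by the generators with index at least `a`. -/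
def tail (m a : ℕ) : Subgroup (CoxeterSymm m) := Subgroup.closure (gen '' {i | a ≤ (i : ℕ)})

theorem shift_mem_tail {m a : ℕ} {k : CoxeterSymm m} (hk : k ∈ tail m a) :
    shift m k ∈ tail (m + 1) (a + 1) := by
  have : tail m a ≤ (tail (m + 1) (a + 1)).comap (shift m) := by
    rw [tail, Subgroup.closure_le]
    rintro _ ⟨i, hi, rfl⟩
    rw [SetLike.mem_coe, Subgroup.mem_comap, shift_gen]
    exact Subgroup.subset_closure ⟨_, by simpa using hi, rfl⟩
  exact this hk

theorem mem_tail_zero {m : ℕ} (w : CoxeterSymm m) : w ∈ tail m 0 := by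
  induction w using induction with
  | one => exact one_mem _
  | mul i w ih => exact mul_mem (Subgroup.subset_closure ⟨i, by simp, rfl⟩) ih

theorem mem_tail_one {m : ℕ} {w : CoxeterSymm m} (h : toPerm m w 0 = 0) : w ∈ tail m 1 := by
  cases m with
  | zero =>
    induction w using induction with
    | one => exact one_mem _
    | mul i => exact i.elim0
  | succ m =>
    obtain ⟨k, rfl⟩ := mem_range_shift h
    exact shift_mem_tail (mem_tail_zero k)

/-- The stabilizer of the first two letters is the stabilizer of the arrow from `0` to `1`; its
generators all commute with `σ_{0,t}` and `ρ_0`. -/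
theorem mem_tail_two {m : ℕ} {w : CoxeterSymm (m + 1)} (h0 : toPerm (m + 1) w 0 = 0)
    (h1 : toPerm (m + 1) w 1 = 1) : w ∈ tail (m + 1) 2 := by
  obtain ⟨k, rfl⟩ := mem_range_shift h0
  refine shift_mem_tail (mem_tail_one (Fin.succ_injective _ ?_))
  rw [← toPerm_shift_succ]
  exact h1

end CoxeterSymm

end UniversalWelded

/-! ### The universal property of the welded group. -/

namespace UniversalWelded

/-- Two families of elements of a group that satisfy the relations of the universal welded braid
group. -/
structure IsWeldedSystem {k c : ℕ} {G : Type*} [Group G] (r : Fin k → G) (s : Fin k → Fin c → G) :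
    Prop where
  mul_self : ∀ i, r i * r i = 1
  far : ∀ i j, Far i j → Commute (r i) (r j)
  braid : ∀ i j, Next i j → r i * r j * r i = r j * r i * r j
  far_sigma : ∀ i j t l, Far i j → Commute (s i t) (s j l)
  far_sigma_rho : ∀ i j t, Far i j → Commute (s i t) (r j)
  mixed : ∀ i j t, Next i j → r i * r j * s i t = s j t * r i * r j
  welded : ∀ i j t, Next i j → r i * s j t * s i t = s j t * s i t * r j

namespace UW

variable {n c : ℕ}

/-- The class of `ρ_i`. -/
def rho (i : Fin (n - 1)) : UW n c := QuotientGroup.mk (PresentedGroup.of (Gen.rho i))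

/-- The class of `σ_{i,t}`. -/
def sigma (i : Fin (n - 1)) (t : Fin c) : UW n c :=
  QuotientGroup.mk (PresentedGroup.of (Gen.sigma i t))

/-- The projection from the free group on the generators. -/
def ofFree (n c : ℕ) : FreeGroup (Gen n c) →* UW n c :=
  (QuotientGroup.mk' _).comp (PresentedGroup.mk {w | VirtualRelator n c w})

theorem ofFree_eq_one {w : FreeGroup (Gen n c)} (h : VirtualRelator n c w) : ofFree n c w = 1 := by
  rw [ofFree, MonoidHom.comp_apply,
    PresentedGroup.one_of_mem (rels := {w | VirtualRelator n c w}) h, map_one]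

theorem ofFree_eq {u v : FreeGroup (Gen n c)} (h : VirtualRelator n c (u * v⁻¹)) :
    ofFree n c u = ofFree n c v := by
  have := ofFree_eq_one h
  rwa [map_mul, map_inv, mul_inv_eq_one] at this

theorem isWeldedSystem (n c : ℕ) : IsWeldedSystem (rho (n := n) (c := c)) sigma where
  mul_self i := by
    have := ofFree_eq_one (VirtualRelator.pr3 (c := c) i)
    rwa [pow_two] at this
  far i j h := ofFree_eq (VirtualRelator.pr2 (c := c) i j h)
  braid i j h := ofFree_eq (VirtualRelator.pr1 (c := c) i j h)
  far_sigma i j t l h := ofFree_eq (VirtualRelator.cr i j t l h)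
  far_sigma_rho i j t h := ofFree_eq (VirtualRelator.mr1 i j t h)
  mixed i j t h := ofFree_eq (VirtualRelator.mr2 i j t h)
  welded i j t h := by
    have : ofFree n c ((ρ i * σ j t * σ i t) * (σ j t * σ i t * ρ j)⁻¹) = 1 :=
      (QuotientGroup.eq_one_iff _).2 (Subgroup.subset_normalClosure ⟨i, j, t, h, rfl⟩)
    rwa [map_mul, map_inv, mul_inv_eq_one] at this

/-- The homomorphism determined by a system of elements that satisfies the relations. -/
def lift {G : Type*} [Group G] {r : Fin (n - 1) → G} {s : Fin (n - 1) → Fin c → G}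
    (h : IsWeldedSystem r s) : UW n c →* G :=
  let f : Gen n c → G := fun x => Gen.casesOn x r s
  have hr : ∀ i, FreeGroup.lift f (ρ i) = r i := fun i => FreeGroup.lift_apply_of
  have hs : ∀ i t, FreeGroup.lift f (σ i t) = s i t := fun i t => FreeGroup.lift_apply_of
  QuotientGroup.lift _ (PresentedGroup.toGroup (f := f) (by
    rintro _ (⟨i, j, hij⟩ | ⟨i, j, hij⟩ | ⟨i⟩ | ⟨i, j, t, l, hij⟩ | ⟨i, j, t, hij⟩ |
      ⟨i, j, t, hij⟩) <;> simp only [map_mul, map_inv, map_pow, hr, hs, mul_inv_eq_one]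
    · exact h.braid i j hij
    · exact h.far i j hij
    · rw [pow_two, h.mul_self]
    · exact h.far_sigma i j t l hij
    · exact h.far_sigma_rho i j t hij
    · exact h.mixed i j t hij)) (by
    intro x hx
    refine MonoidHom.mem_ker.1 (Subgroup.normalClosure_le_normal (N := MonoidHom.ker _) ?_ hx)
    rintro _ ⟨i, j, t, hij, rfl⟩
    change FreeGroup.lift f ((ρ i * σ j t * σ i t) * (σ j t * σ i t * ρ j)⁻¹) = 1
    simp only [map_mul, map_inv, hr, hs, mul_inv_eq_one]
    exact h.welded i j t hij)

@[simp] theorem lift_rho {G : Type*} [Group G] {r : Fin (n - 1) → G} {s : Fin (n - 1) → Fin c → G}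
    (h : IsWeldedSystem r s) (i : Fin (n - 1)) : lift h (rho i) = r i :=
  FreeGroup.lift_apply_of

@[simp] theorem lift_sigma {G : Type*} [Group G] {r : Fin (n - 1) → G}
    {s : Fin (n - 1) → Fin c → G} (h : IsWeldedSystem r s) (i : Fin (n - 1)) (t : Fin c) :
    lift h (sigma i t) = s i t :=
  FreeGroup.lift_apply_of

theorem hom_ext {G : Type*} [Group G] {f g : UW n c →* G} (hr : ∀ i, f (rho i) = g (rho i))
    (hs : ∀ i t, f (sigma i t) = g (sigma i t)) : f = g := by
  refine QuotientGroup.monoidHom_ext _ (PresentedGroup.ext ?_)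
  rintro (i | ⟨i, t⟩)
  · exact hr i
  · exact hs i t

end UW

/-! ### Arrows, their commutation graph, and the semidirect product. -/

/-- A pair of distinct points among `m + 2`, with a label. -/
@[ext] structure Arrow (m c : ℕ) where
  /-- the source -/
  src : Fin (m + 2)
  /-- the target -/
  tgt : Fin (m + 2)
  /-- the label -/
  label : Fin c
  ne : src ≠ tgt

namespace Arrow

variable {m c : ℕ}

instance : Finite (Arrow m c) :=
  Finite.of_injective (fun a : Arrow m c => (a.src, a.tgt, a.label)) (by
    intro a b h
    simp only [Prod.mk.injEq] at h
    exact Arrow.ext h.1 h.2.1 h.2.2)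

instance : MulAction (CoxeterSymm (m + 1)) (Arrow m c) where
  smul w a := ⟨CoxeterSymm.toPerm _ w a.src, CoxeterSymm.toPerm _ w a.tgt, a.label,
    fun h => a.ne ((CoxeterSymm.toPerm _ w).injective h)⟩
  one_smul a := by
    apply Arrow.ext
    · exact DFunLike.congr_fun (map_one (CoxeterSymm.toPerm (m + 1))) a.src
    · exact DFunLike.congr_fun (map_one (CoxeterSymm.toPerm (m + 1))) a.tgt
    · rfl
  mul_smul v w a := by
    apply Arrow.ext
    · exact DFunLike.congr_fun (map_mul (CoxeterSymm.toPerm (m + 1)) v w) a.src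
    · exact DFunLike.congr_fun (map_mul (CoxeterSymm.toPerm (m + 1)) v w) a.tgt
    · rfl

@[simp] theorem smul_src (w : CoxeterSymm (m + 1)) (a : Arrow m c) :
    (w • a).src = CoxeterSymm.toPerm _ w a.src := rfl

@[simp] theorem smul_tgt (w : CoxeterSymm (m + 1)) (a : Arrow m c) :
    (w • a).tgt = CoxeterSymm.toPerm _ w a.tgt := rfl

@[simp] theorem smul_label (w : CoxeterSymm (m + 1)) (a : Arrow m c) :
    (w • a).label = a.label := rfl

/-- The graph of commuting arrows: the disjoint ones, and those with the same target and label. -/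
def graph (m c : ℕ) : SimpleGraph (Arrow m c) where
  Adj a b := (a.src ≠ b.src ∧ a.src ≠ b.tgt ∧ a.tgt ≠ b.src ∧ a.tgt ≠ b.tgt) ∨
    (a.src ≠ b.src ∧ a.tgt = b.tgt ∧ a.label = b.label)
  symm := by
    constructor
    rintro a b (⟨h1, h2, h3, h4⟩ | ⟨h1, h2, h3⟩)
    · exact Or.inl ⟨h1.symm, h3.symm, h2.symm, h4.symm⟩
    · exact Or.inr ⟨h1.symm, h2.symm, h3.symm⟩
  loopless := by
    constructor
    rintro a (h | h) <;> exact h.1 rfl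

theorem graph_adj_smul (w : CoxeterSymm (m + 1)) (a b : Arrow m c) (h : (graph m c).Adj a b) :
    (graph m c).Adj (w • a) (w • b) := by
  simpa [graph] using h

theorem exists_not_adj (a : Arrow m c) : ∃ b, b ≠ a ∧ ¬ (graph m c).Adj a b := by
  -- The reversed arrow is neither disjoint from `a` nor has the same target.
  refine ⟨⟨a.tgt, a.src, a.label, a.ne.symm⟩, fun h => a.ne (congrArg tgt h), ?_⟩
  rintro (h | h)
  · exact h.2.1 rfl
  · exact a.ne h.2.1.symm

theorem eq_one_of_smul_eq [NeZero c] (w : CoxeterSymm (m + 1)) (h : ∀ a : Arrow m c, w • a = a) :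
    w = 1 := by
  apply CoxeterSymm.eq_one_of_toPerm_eq_one
  ext1 x
  -- The label `0` exists because `c ≠ 0`; without labels there would be no arrows and no
  -- faithfulness.
  obtain ⟨y, hy⟩ := exists_ne x
  exact congrArg src (h ⟨x, y, 0, hy.symm⟩)

/-- The arrow from `i` to `i + 1`. -/
def edge (i : Fin (m + 1)) (t : Fin c) : Arrow m c :=
  ⟨i.castSucc, i.succ, t, i.castSucc_lt_succ.ne⟩

theorem gen_smul_edge_of_far {i j : Fin (m + 1)} (h : Far i j) (t : Fin c) :
    CoxeterSymm.gen i • edge j t = edge j t := by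
  have h1 : (i : ℕ) ≠ j := by rcases h with h | h <;> omega
  have h2 : (i : ℕ) + 1 ≠ j := by rcases h with h | h <;> omega
  have h3 : (i : ℕ) ≠ j + 1 := by rcases h with h | h <;> omega
  apply Arrow.ext
  · rw [smul_src, CoxeterSymm.toPerm_gen]
    exact Equiv.swap_apply_of_ne_of_ne (by simp [edge, Fin.ext_iff]; omega)
      (by simp [edge, Fin.ext_iff]; omega)
  · rw [smul_tgt, CoxeterSymm.toPerm_gen]
    exact Equiv.swap_apply_of_ne_of_ne (by simp [edge, Fin.ext_iff]; omega)
      (by simp [edge, Fin.ext_iff]; omega)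
  · rfl

theorem gen_smul_edge_succ {i j : Fin (m + 1)} (h : Next i j) (t : Fin c) :
    CoxeterSymm.gen i • edge j t = CoxeterSymm.gen j • edge i t := by
  have hij : i.succ = j.castSucc := Fin.ext h.symm
  have hv : (j : ℕ) = i + 1 := h
  apply Arrow.ext
  · simp only [smul_src, CoxeterSymm.toPerm_gen, edge]
    rw [← hij, Equiv.swap_apply_right, Equiv.swap_apply_of_ne_of_ne]
    · simp [Fin.ext_iff]
    · simp [Fin.ext_iff]; omega
  · simp only [smul_tgt, CoxeterSymm.toPerm_gen, edge]
    rw [hij, Equiv.swap_apply_left, Equiv.swap_apply_of_ne_of_ne]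
    · simp [Fin.ext_iff]; omega
    · simp [Fin.ext_iff]
  · rfl

theorem gen_smul_gen_smul_edge {i j : Fin (m + 1)} (h : Next i j) (t : Fin c) :
    CoxeterSymm.gen i • CoxeterSymm.gen j • edge i t = edge j t := by
  rw [← gen_smul_edge_succ h, ← mul_smul, CoxeterSymm.gen_mul_self, one_smul]

theorem edge_adj_of_far {i j : Fin (m + 1)} (h : Far i j) (t l : Fin c) :
    (graph m c).Adj (edge i t) (edge j l) := by
  refine Or.inl ?_
  simp only [edge, Ne, Fin.ext_iff, Fin.val_castSucc, Fin.val_succ]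
  rcases h with h | h <;> omega

/-- These are the arrows from `i + 1` and from `i` to `i + 2`; their common target is the
commutation that the welded relation encodes. -/
theorem edge_adj_gen_smul_edge {i j : Fin (m + 1)} (h : Next i j) (t : Fin c) :
    (graph m c).Adj (edge j t) (CoxeterSymm.gen i • edge j t) := by
  have hij : i.succ = j.castSucc := Fin.ext h.symm
  have hv : (j : ℕ) = i + 1 := h
  refine Or.inr ⟨?_, ?_, rfl⟩
  · simp only [smul_src, CoxeterSymm.toPerm_gen, edge]
    rw [← hij, Equiv.swap_apply_right]
    exact i.castSucc_lt_succ.ne'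
  · simp only [smul_tgt, CoxeterSymm.toPerm_gen, edge]
    rw [Equiv.swap_apply_of_ne_of_ne]
    · simp [Fin.ext_iff]; omega
    · simp [Fin.ext_iff]; omega

/-- The semidirect product of the right-angled Artin group of arrows with the symmetric group. -/
abbrev Semi (m c : ℕ) : Type := RightAngledArtin (graph m c) ⋊[RightAngledArtin.autOfAction
  (graph m c) (CoxeterSymm (m + 1)) graph_adj_smul] CoxeterSymm (m + 1)

/-- The image of `σ_{i,t}` in the semidirect product. -/
def semiSigma (i : Fin (m + 1)) (t : Fin c) : Semi m c :=
  SemidirectProduct.inl (RightAngledArtin.gen _ (edge i t)) *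
    SemidirectProduct.inr (CoxeterSymm.gen i)

theorem isWeldedSystem_semi (m c : ℕ) : IsWeldedSystem
    (fun i : Fin (m + 1) => (SemidirectProduct.inr (CoxeterSymm.gen i) : Semi m c))
    semiSigma where
  mul_self i := by rw [← map_mul, CoxeterSymm.gen_mul_self, map_one]
  far i j h := (CoxeterSymm.gen_commute h).map _
  braid i j h := by simp only [← map_mul, CoxeterSymm.gen_braid h]
  far_sigma i j t l h := by
    ext1
    · simpa [semiSigma, gen_smul_edge_of_far h, gen_smul_edge_of_far h.symm] using
        (RightAngledArtin.commute_gen (edge_adj_of_far h t l)).eq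
    · simpa [semiSigma] using (CoxeterSymm.gen_commute h).eq
  far_sigma_rho i j t h := by
    ext1
    · simp [semiSigma, gen_smul_edge_of_far h.symm]
    · simpa [semiSigma] using (CoxeterSymm.gen_commute h).eq
  mixed i j t h := by
    ext1
    · simp [semiSigma, gen_smul_gen_smul_edge h]
    · simpa [semiSigma] using CoxeterSymm.gen_braid h
  -- The free-standing parts of the two sides are the products of the generators at `gen i • edge j
  -- t` and `edge j t` in the two orders.
  welded i j t h := by
    ext1
    · simpa [semiSigma, mul_smul, gen_smul_gen_smul_edge h, gen_smul_edge_succ h] using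
        (RightAngledArtin.commute_gen (edge_adj_gen_smul_edge h t)).symm.eq
    · simpa [semiSigma, mul_assoc] using CoxeterSymm.gen_braid h

end Arrow

end UniversalWelded

/-! ### Arrow elements in any group satisfying the welded relations. -/

namespace UniversalWelded

open Arrow

namespace IsWeldedSystem

variable {m c : ℕ} {G : Type*} [Group G] {r : Fin (m + 1) → G} {s : Fin (m + 1) → Fin c → G}

/-- The homomorphism from the symmetric group. -/
def symmHom (h : IsWeldedSystem r s) : CoxeterSymm (m + 1) →* G :=
  CoxeterSymm.lift r h.mul_self h.far h.braid

@[simp] theorem symmHom_gen (h : IsWeldedSystem r s) (i : Fin (m + 1)) :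
    h.symmHom (CoxeterSymm.gen i) = r i := CoxeterSymm.lift_gen _ _ _ _ i

end IsWeldedSystem

theorem Arrow.exists_smul_edge_eq {m c : ℕ} (a : Arrow m c) :
    ∃ w : CoxeterSymm (m + 1), w • edge 0 a.label = a := by
  obtain ⟨p, hp⟩ := Equiv.Perm.exists_extending_pair ![(0 : Fin (m + 2)), 1] ![a.src, a.tgt]
    (by intro x y; fin_cases x <;> fin_cases y <;> simp)
    (by intro x y; fin_cases x <;> fin_cases y <;> simp [a.ne, a.ne.symm])
  obtain ⟨w, rfl⟩ := CoxeterSymm.toPerm_surjective _ p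
  exact ⟨w, Arrow.ext (hp 0) (hp 1) rfl⟩

theorem Arrow.exists_smul_edge_eq_of_disjoint {m c : ℕ} {a b : Arrow m c} (h1 : a.src ≠ b.src)
    (h2 : a.src ≠ b.tgt) (h3 : a.tgt ≠ b.src) (h4 : a.tgt ≠ b.tgt) :
    ∃ i j : Fin (m + 1), Far i j ∧ ∃ w : CoxeterSymm (m + 1),
      w • edge i a.label = a ∧ w • edge j b.label = b := by
  have hinj : Function.Injective ![a.src, a.tgt, b.src, b.tgt] := by
    have := a.ne
    have := b.ne
    intro x y
    fin_cases x <;> fin_cases y <;> simp [*, Ne.symm, eq_comm] <;> simp_all [eq_comm]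
  -- Four distinct endpoints leave room for the edges `0` and `2`; the permutation takes the letters
  -- `0, 1, 2, 3` to these endpoints.
  have hm : 4 ≤ m + 2 := by simpa using Fintype.card_le_of_injective _ hinj
  obtain ⟨p, hp⟩ := Equiv.Perm.exists_extending_pair (Fin.castLE hm) _
    (Fin.castLE_injective hm) hinj
  obtain ⟨w, rfl⟩ := CoxeterSymm.toPerm_surjective _ p
  exact ⟨⟨0, by omega⟩, ⟨2, by omega⟩, Or.inl le_rfl, w, Arrow.ext (hp 0) (hp 1) rfl,
    Arrow.ext (hp 2) (hp 3) rfl⟩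

theorem Arrow.exists_smul_edge_eq_of_tgt_eq {m c : ℕ} {a b : Arrow m c} (h1 : a.src ≠ b.src)
    (h2 : a.tgt = b.tgt) (h3 : a.label = b.label) :
    ∃ i j : Fin (m + 1), Next i j ∧ ∃ w : CoxeterSymm (m + 1),
      w • CoxeterSymm.gen j • edge i a.label = a ∧ w • edge j a.label = b := by
  have hinj : Function.Injective ![a.src, b.src, b.tgt] := by
    have := a.ne
    have := b.ne
    intro x y
    fin_cases x <;> fin_cases y <;> simp [*, Ne.symm, eq_comm] <;> simp_all
  have hm : 3 ≤ m + 2 := by simpa using Fintype.card_le_of_injective _ hinj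
  obtain ⟨p, hp⟩ := Equiv.Perm.exists_extending_pair (Fin.castLE hm) _
    (Fin.castLE_injective hm) hinj
  obtain ⟨w, rfl⟩ := CoxeterSymm.toPerm_surjective _ p
  -- Here `gen 1 • edge 0` is the arrow from `0` to `2` and `edge 1` the arrow from `1` to `2`, so
  -- the letters `0, 1, 2` go to the two sources and the common target.
  refine ⟨⟨0, by omega⟩, ⟨1, by omega⟩, rfl, w, Arrow.ext ?_ ?_ rfl,
    Arrow.ext (hp 1) (hp 2) h3⟩
  · refine Eq.trans ?_ (hp 0)
    rw [smul_src, smul_src, CoxeterSymm.toPerm_gen]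
    refine congrArg _ (Equiv.swap_apply_of_ne_of_ne ?_ ?_) <;> simp [edge, Fin.ext_iff]
  · refine Eq.trans ?_ ((hp 2).trans h2.symm)
    rw [smul_tgt, smul_tgt, CoxeterSymm.toPerm_gen]
    exact congrArg _ (Equiv.swap_apply_left _ _)

namespace IsWeldedSystem

variable {m c : ℕ} {G : Type*} [Group G] {r : Fin (m + 1) → G} {s : Fin (m + 1) → Fin c → G}

/-- The element attached to an arrow. -/
noncomputable def arrowElt (h : IsWeldedSystem r s) (a : Arrow m c) : G :=
  h.symmHom a.exists_smul_edge_eq.choose * (s 0 a.label * r 0) *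
    (h.symmHom a.exists_smul_edge_eq.choose)⁻¹

/-- This is what makes `arrowElt` independent of the chosen permutation. -/
theorem commute_of_smul_edge_eq (h : IsWeldedSystem r s) {w : CoxeterSymm (m + 1)} {t : Fin c}
    (hw : w • edge (m := m) 0 t = edge 0 t) : Commute (h.symmHom w) (s 0 t * r 0) := by
  have hmem := CoxeterSymm.mem_tail_two (congrArg src hw) (congrArg tgt hw)
  have hle : CoxeterSymm.tail (m + 1) 2 ≤
      (Subgroup.centralizer {s 0 t * r 0}).comap h.symmHom := by
    rw [CoxeterSymm.tail, Subgroup.closure_le]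
    rintro _ ⟨i, hi, rfl⟩
    have hfar : Far 0 i := Or.inl (by simpa using hi)
    rw [SetLike.mem_coe, Subgroup.mem_comap, Subgroup.mem_centralizer_singleton_iff, symmHom_gen]
    exact ((h.far_sigma_rho 0 i t hfar).mul_left (h.far 0 i hfar)).symm.eq
  exact Subgroup.mem_centralizer_singleton_iff.1 (hle hmem)

theorem arrowElt_smul_edge_zero (h : IsWeldedSystem r s) (w : CoxeterSymm (m + 1)) (t : Fin c) :
    h.arrowElt (w • edge 0 t) = h.symmHom w * (s 0 t * r 0) * (h.symmHom w)⁻¹ := by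
  have hv := (w • edge (m := m) 0 t).exists_smul_edge_eq.choose_spec
  set v := (w • edge (m := m) 0 t).exists_smul_edge_eq.choose with hvdef
  have hfix : (w⁻¹ * v) • edge (m := m) 0 t = edge 0 t := by
    rw [mul_smul, inv_smul_eq_iff]
    exact hv
  have hc := (h.commute_of_smul_edge_eq hfix).eq
  rw [arrowElt, ← hvdef]
  change h.symmHom v * (s 0 t * r 0) * (h.symmHom v)⁻¹ = _
  rw [map_mul, map_inv] at hc
  rw [mul_inv_eq_iff_eq_mul]
  calc h.symmHom v * (s 0 t * r 0)
      = h.symmHom w * ((h.symmHom w)⁻¹ * h.symmHom v * (s 0 t * r 0)) := by group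
    _ = _ := by rw [hc]; group

theorem arrowElt_smul (h : IsWeldedSystem r s) (w : CoxeterSymm (m + 1)) (a : Arrow m c) :
    h.arrowElt (w • a) = h.symmHom w * h.arrowElt a * (h.symmHom w)⁻¹ := by
  obtain ⟨v, hv⟩ := a.exists_smul_edge_eq
  rw [← hv, ← mul_smul, arrowElt_smul_edge_zero, arrowElt_smul_edge_zero, map_mul, mul_inv_rev]
  simp only [mul_assoc]

/-- Conjugation by `ρ_i ρ_{i+1}` carries each edge to the next, and by the mixed relation it does
the same to `σ_{i,t} ρ_i`. -/
theorem arrowElt_edge (h : IsWeldedSystem r s) (i : Fin (m + 1)) (t : Fin c) :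
    h.arrowElt (edge i t) = s i t * r i := by
  induction i using Fin.induction with
  | zero => simpa using h.arrowElt_smul_edge_zero 1 t
  | succ i ih =>
    have hn : Next i.castSucc i.succ := by simp [Next]
    rw [← gen_smul_gen_smul_edge hn, arrowElt_smul, arrowElt_smul, ih, symmHom_gen, symmHom_gen]
    have hi : (r i.castSucc)⁻¹ = r i.castSucc := inv_eq_of_mul_eq_one_left (h.mul_self _)
    have hj : (r i.succ)⁻¹ = r i.succ := inv_eq_of_mul_eq_one_left (h.mul_self _)
    have hb := h.braid _ _ hn
    have hm := h.mixed _ _ t hn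
    rw [hi, hj]
    calc r i.castSucc * (r i.succ * (s i.castSucc t * r i.castSucc) * r i.succ) * r i.castSucc
        = r i.castSucc * r i.succ * s i.castSucc t *
            (r i.castSucc * r i.succ * r i.castSucc) := by simp only [mul_assoc]
      _ = s i.succ t * r i.castSucc * (r i.succ * r i.succ) * r i.castSucc * r i.succ := by
          rw [hm, hb]; simp only [mul_assoc]
      _ = s i.succ t * (r i.castSucc * r i.castSucc) * r i.succ := by
          rw [h.mul_self, mul_one]; simp only [mul_assoc]
      _ = s i.succ t * r i.succ := by rw [h.mul_self, mul_one]

/-- Here `p, q, x, y` stand for `ρ_i, ρ_{i+1}, σ_{i+1,t}, σ_{i,t}`. The mixed relation expresses `y`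
through the others; substituting this turns the welded relation into a commutation. -/
theorem welded_commute {p q x y : G} (hp : p * p = 1) (hq : q * q = 1)
    (hb : p * q * p = q * p * q) (hm : p * q * y = x * p * q) (hw : p * x * y = x * y * q) :
    Commute (p * (x * q) * p) (x * q) := by
  have hy : y = q * p * x * p * q := by
    calc y = q * (p * p) * q * y := by rw [hp, mul_one, hq, one_mul]
      _ = q * p * (p * q * y) := by simp only [mul_assoc]
      _ = _ := by rw [hm]; simp only [mul_assoc]
  have hpq : p * q * p * q = q * p := by rw [hb, mul_assoc, hq, mul_one]
  have hqpq : p * (q * q) * p * q = q := by rw [hq, mul_one, hp, one_mul]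
  calc p * (x * q) * p * (x * q) = p * x * q * p * x * (p * (q * q) * p * q) := by
        rw [hqpq]; simp only [mul_assoc]
    _ = p * x * (q * p * x * p * q) * (q * p * q) := by simp only [mul_assoc]
    _ = x * y * (q * q) * p * q := by rw [← hy, hw]; simp only [mul_assoc]
    _ = x * q * p * x * (p * q * p * q) := by rw [hq, mul_one, hy]; simp only [mul_assoc]
    _ = x * q * (p * (x * q) * p) := by rw [hpq]; simp only [mul_assoc]

theorem arrowElt_commute (h : IsWeldedSystem r s) {a b : Arrow m c} (hab : (graph m c).Adj a b) :
    Commute (h.arrowElt a) (h.arrowElt b) := by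
  rcases hab with ⟨h1, h2, h3, h4⟩ | ⟨h1, h2, h3⟩
  · obtain ⟨i, j, hf, w, ha, hb⟩ := Arrow.exists_smul_edge_eq_of_disjoint h1 h2 h3 h4
    rw [← ha, ← hb, arrowElt_smul, arrowElt_smul, arrowElt_edge, arrowElt_edge]
    rw [Commute.conj_iff]
    exact ((h.far_sigma i j _ _ hf).mul_right (h.far_sigma_rho i j _ hf)).mul_left
      ((h.far_sigma_rho j i _ hf.symm).symm.mul_right (h.far i j hf))
  · obtain ⟨i, j, hn, w, ha, hb⟩ := Arrow.exists_smul_edge_eq_of_tgt_eq h1 h2 h3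
    rw [← ha, ← hb, ← gen_smul_edge_succ hn, arrowElt_smul, arrowElt_smul h w (edge j _),
      Commute.conj_iff, arrowElt_smul, arrowElt_edge, symmHom_gen,
      inv_eq_of_mul_eq_one_left (h.mul_self i)]
    exact welded_commute (h.mul_self i) (h.mul_self j) (h.braid i j hn) (h.mixed i j _ hn)
      (h.welded i j _ hn)

/-- The homomorphism from the semidirect product. -/
noncomputable def fromSemi (h : IsWeldedSystem r s) : Semi m c →* G :=
  SemidirectProduct.lift (RightAngledArtin.lift h.arrowElt fun _ _ => h.arrowElt_commute) h.symmHom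
    fun w => RightAngledArtin.hom_ext fun a => by simp [arrowElt_smul]

theorem fromSemi_inr (h : IsWeldedSystem r s) (w : CoxeterSymm (m + 1)) :
    h.fromSemi (SemidirectProduct.inr w) = h.symmHom w := SemidirectProduct.lift_inr _ _ _ _

theorem fromSemi_inl_gen (h : IsWeldedSystem r s) (a : Arrow m c) :
    h.fromSemi (SemidirectProduct.inl (RightAngledArtin.gen _ a)) = h.arrowElt a :=
  (SemidirectProduct.lift_inl _ _ _ _).trans (RightAngledArtin.lift_gen _ _ _)

end IsWeldedSystem

/-! ### Comparison with the semidirect product, the center, and the case `n = 2`. -/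

namespace UW

/-- The homomorphism to the semidirect product. -/
def toSemi (m c : ℕ) : UW (m + 2) c →* Semi m c := lift (n := m + 2) (isWeldedSystem_semi m c)

theorem toSemi_rho {m c : ℕ} (i : Fin (m + 1)) :
    toSemi m c (rho (n := m + 2) i) = SemidirectProduct.inr (CoxeterSymm.gen i) :=
  lift_rho (n := m + 2) (isWeldedSystem_semi m c) i

theorem toSemi_sigma {m c : ℕ} (i : Fin (m + 1)) (t : Fin c) :
    toSemi m c (sigma (n := m + 2) i t) = semiSigma i t :=
  lift_sigma (n := m + 2) (isWeldedSystem_semi m c) i t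

theorem fromSemi_toSemi {m c : ℕ} (z : UW (m + 2) c) :
    IsWeldedSystem.fromSemi (m := m) (isWeldedSystem (m + 2) c) (toSemi m c z) = z := by
  have : (IsWeldedSystem.fromSemi (m := m) (isWeldedSystem (m + 2) c)).comp (toSemi m c) =
      MonoidHom.id _ := by
    refine hom_ext (fun (i : Fin (m + 1)) => ?_) fun (i : Fin (m + 1)) t => ?_
    · rw [MonoidHom.comp_apply, toSemi_rho, IsWeldedSystem.fromSemi_inr,
        IsWeldedSystem.symmHom_gen, MonoidHom.id_apply]
    · rw [MonoidHom.comp_apply, toSemi_sigma, semiSigma, map_mul, IsWeldedSystem.fromSemi_inr,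
        IsWeldedSystem.fromSemi_inl_gen, IsWeldedSystem.arrowElt_edge, IsWeldedSystem.symmHom_gen,
        mul_assoc, IsWeldedSystem.mul_self (isWeldedSystem (m + 2) c), mul_one, MonoidHom.id_apply]
  exact DFunLike.congr_fun this z

theorem toSemi_symmHom {m c : ℕ} (w : CoxeterSymm (m + 1)) :
    toSemi m c (IsWeldedSystem.symmHom (m := m) (isWeldedSystem (m + 2) c) w) =
      SemidirectProduct.inr w := by
  have : (toSemi m c).comp (IsWeldedSystem.symmHom (m := m) (isWeldedSystem (m + 2) c)) =
      SemidirectProduct.inr := by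
    refine PresentedGroup.ext fun i => ?_
    exact (congrArg _ (IsWeldedSystem.symmHom_gen (m := m) (isWeldedSystem (m + 2) c) i)).trans
      (toSemi_rho i)
  exact DFunLike.congr_fun this w

/-- It puts all arrow generators in the image of `toSemi`, so the image of a central element
commutes with each of them. -/
theorem toSemi_arrowElt {m c : ℕ} (a : Arrow m c) :
    toSemi m c (IsWeldedSystem.arrowElt (isWeldedSystem (m + 2) c) a) =
      SemidirectProduct.inl (RightAngledArtin.gen _ a) := by
  obtain ⟨w, hw⟩ := a.exists_smul_edge_eq
  rw [← hw, IsWeldedSystem.arrowElt_smul, IsWeldedSystem.arrowElt_edge, map_mul, map_mul, map_mul,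
    map_inv, toSemi_symmHom, toSemi_rho, toSemi_sigma, semiSigma, mul_assoc (SemidirectProduct.inl _),
    ← map_mul, CoxeterSymm.gen_mul_self, map_one, mul_one, ← map_inv,
    ← SemidirectProduct.inl_aut, RightAngledArtin.autOfAction_gen]

theorem center_eq_bot {n c : ℕ} (hn : 2 ≤ n) (hc : 1 ≤ c) : Subgroup.center (UW n c) = ⊥ := by
  obtain ⟨m, rfl⟩ : ∃ m, n = m + 2 := ⟨n - 2, by omega⟩
  have : NeZero c := ⟨by omega⟩
  rw [eq_bot_iff]
  intro z hz
  have hone : toSemi m c z = 1 := by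
    refine RightAngledArtin.semidirectProduct_eq_one_of_commute exists_not_adj graph_adj_smul
      (fun w => eq_one_of_smul_eq w) fun a => ?_
    rw [← toSemi_arrowElt]
    exact Commute.map (Subgroup.mem_center_iff.1 hz _).symm (toSemi m c)
  rw [Subgroup.mem_bot, ← fromSemi_toSemi z, hone, map_one]

theorem isWeldedSystem_coprod (c : ℕ) : IsWeldedSystem
    (fun _ : Fin 1 => (Monoid.Coprod.inr (Multiplicative.ofAdd 1) :
      Monoid.Coprod (FreeGroup (Fin c)) (Multiplicative (ZMod 2))))
    (fun _ t => Monoid.Coprod.inl (FreeGroup.of t)) where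
  mul_self i := by
    rw [← map_mul, ← ofAdd_add]
    exact map_one _
  far i j h := Commute.refl _
  braid i j h := rfl
  -- With a single index there are no far and no consecutive pairs.
  far_sigma i j t l h := by have := i.2; have := j.2; rcases h with h | h <;> omega
  far_sigma_rho i j t h := by have := i.2; have := j.2; rcases h with h | h <;> omega
  mixed i j t h := by have := i.2; have := j.2; unfold Next at h; omega
  welded i j t h := by have := i.2; have := j.2; unfold Next at h; omega

/-- The homomorphism from the group of order two given by an involution. -/
def homOfInvolution {G : Type*} [Group G] (x : G) (hx : x * x = 1) :
    Multiplicative (ZMod 2) →* G :=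
  AddMonoidHom.toMultiplicativeLeft (ZMod.lift 2 ⟨zmultiplesHom (Additive G) (Additive.ofMul x), 
    (two_zsmul (Additive.ofMul x)).trans hx⟩)

theorem homOfInvolution_ofAdd_one {G : Type*} [Group G] (x : G) (hx : x * x = 1) :
    homOfInvolution x hx (Multiplicative.ofAdd 1) = x := by
  have := ZMod.lift_coe 2 (A := Additive G) ⟨zmultiplesHom (Additive G) (Additive.ofMul x), 
    (two_zsmul (Additive.ofMul x)).trans hx⟩ 1
  simp only [Int.cast_one] at this
  refine (congrArg Additive.toMul this).trans ?_
  simp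

/-- `UW_2(c)` is the free product of a free group and a group of order two. -/
def equivCoprod (c : ℕ) :
    UW 2 c ≃* Monoid.Coprod (FreeGroup (Fin c)) (Multiplicative (ZMod 2)) :=
  MonoidHom.toMulEquiv (lift (n := 2) (isWeldedSystem_coprod c))
    (Monoid.Coprod.lift (FreeGroup.lift fun t => sigma (n := 2) 0 t)
      (homOfInvolution (rho (n := 2) 0) ((isWeldedSystem 2 c).mul_self 0)))
    (by
      refine hom_ext (fun i => ?_) fun i t => ?_
      · obtain rfl : i = (0 : Fin 1) := Subsingleton.elim (α := Fin 1) i 0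
        simp [homOfInvolution_ofAdd_one]
      · obtain rfl : i = (0 : Fin 1) := Subsingleton.elim (α := Fin 1) i 0
        simp)
    (by
      refine Monoid.Coprod.hom_ext ?_ ?_
      · ext t
        simp
      · refine MonoidHom.ext fun x => ?_
        have hx : ∀ x : Multiplicative (ZMod 2), x = 1 ∨ x = Multiplicative.ofAdd 1 := by decide
        rcases hx x with rfl | rfl
        · simp only [map_one]
        · simp [homOfInvolution_ofAdd_one])

end UW

end UniversalWelded

theorem proposition5p5 (c : ℕ) (hc : 1 ≤ c) :
    (∀ n : ℕ, 3 ≤ n → Subgroup.center (UniversalWelded.UW n c) = ⊥) ∧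
    Nonempty (UniversalWelded.UW 2 c ≃*
      Monoid.Coprod (FreeGroup (Fin c)) (Multiplicative (ZMod 2))) ∧
    Subgroup.center (UniversalWelded.UW 2 c) = ⊥ :=
  ⟨fun _ hn => UniversalWelded.UW.center_eq_bot (by omega) hc,
    ⟨UniversalWelded.UW.equivCoprod c⟩, UniversalWelded.UW.center_eq_bot le_rfl hc⟩
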